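/- For $d\in\mathbb N$ let $S_d^+$ be the cone of real symmetric positive semidefinite $d\times d$ matrices. For a probability measure $\mu$ on (the Borel sets of) $S_d^+$, define its Laplace transform by $\mathcal L(\mu)(u)=\int_{S_d^+} e^{\operatorname{tr}(u\xi)}\,\mu(d\xi)$ for $u\in -S_d^+$. For $r\ge 1$ let $$\Lambda_r=\Big(\big\{\tfrac j2 : j=1,\dots,r-2\big\}\cup\big[\tfrac{r-1}{2},\infty\big)\Big)\setminus\{0\}$$ be the Gindikin ensemble (in particular $\Lambda_1=(0,\infty)$). Theorem. Let $d\in\mathbb N$, $p\ge 0$, and let $\sigma\in S_d^+$, $\sigma\neq 0$, have rank $r$. The following are equivalent: (1) There is a probability measure $\mu$ on $S_d^+$, different from the point mass at $0$, such that $\mathcal L(\mu)(u)=\big(\det(I-\sigma u)\big)^{-p}$ for all $u\in -S_d^+$. (2) $p\in\Lambda_r$. -/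

import Mathlib

open MeasureTheory

/-- The cone `S_d^+` of real symmetric positive semidefinite `d × d` matrices, as a type,
with the topology induced from the space of matrices. -/
abbrev PSDCone (d : ℕ) : Type :=
  {A : Matrix (Fin d) (Fin d) ℝ // A.PosSemidef}

/-- `S_d^+` carries its Borel `σ`-algebra. -/
instance PSDCone.instMeasurableSpace (d : ℕ) : MeasurableSpace (PSDCone d) :=
  borel (PSDCone d)

instance PSDCone.instBorelSpace (d : ℕ) : BorelSpace (PSDCone d) := ⟨rfl⟩

/-- The point `0` of the cone `S_d^+`. -/
def PSDCone.origin (d : ℕ) : PSDCone d := ⟨0, Matrix.PosSemidef.zero⟩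

/-- The Laplace transform `u ↦ ∫ exp (tr (u ξ)) μ(dξ)` of a measure `μ` on `S_d^+`. It is used for
`u ∈ -S_d^+`, where the integrand takes values in `(0, 1]`. -/
noncomputable def laplaceTransform {d : ℕ} (μ : Measure (PSDCone d))
    (u : Matrix (Fin d) (Fin d) ℝ) : ℝ :=
  ∫ ξ : PSDCone d, Real.exp (u * ξ.val).trace ∂μ

/-- The Gindikin ensemble
`Λ_r = {j / 2 : j = 1, …, r - 2} ∪ [(r - 1) / 2, ∞)`, with the convention that it does not
contain `0`, so that `Λ_1 = (0, ∞)`. -/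
def gindikinEnsemble (r : ℕ) : Set ℝ :=
  ({x : ℝ | ∃ j : ℕ, 1 ≤ j ∧ j + 2 ≤ r ∧ x = (j : ℝ) / 2} ∪ Set.Ici (((r : ℝ) - 1) / 2)) ∩
    Set.Ioi 0

/-!
The Laplace transform `det (1 - σ u) ^ (-p)` belongs to a Wishart distribution with shape
parameter `p`. Writing `σ = A Aᵀ` with a `d × r` matrix `A` that has a left inverse, and
transporting measures by congruences, one reduces to the `r × r` identity as scale matrix.

*Existence* is the Bartlett decomposition. If `ξ'` has a Wishart distribution on `S_n^+` with
parameter `p - 1 / 2`, `g` is gamma distributed with parameter `p`, and `x` is Gaussian with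
covariance `I / 2`, all independent, then `(√g, x) (√g, x)ᵀ + 0 ⊕ ξ'` has a Wishart distribution
on `S_{n+1}^+` with parameter `p` (`HasWishart.succ`), by the Schur complement factorization of
`det (1 - u)`. The recursion ends in the `0 × 0` case, where every `p` is allowed, which yields
`p ≥ (n - 1) / 2`, or at `p = 0`, which yields the half integers (`hasWishart_of_mem`).

*Necessity* is a positivity argument. After an exponential tilt and a rescaling, the Laplace
transform formula holds in a neighbourhood of the origin. Differentiating it and using that Laplace
transforms determine finite measures on the cone, one finds the moments of the first row of `ξ`
conditionally on the lower right block `ξ'`: the corner has mean `p`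
(`IsWishart.integral_corner_mul`) and the rest of the row has second moment matrix `ξ' / 2`
(`IsWishart.integral_border_mul_border_mul`). On the event that `ξ'` is invertible, its Schur
complement in `ξ` therefore has conditional mean `p - n / 2` (`IsWishart.integral_schur`). But this
Schur complement is nonnegative, and it vanishes where `ξ` is singular. So if `p < n / 2` then `ξ'`
is almost surely singular; and from there, unless `p` is one of the values `j / 2` with `j < n`,
singularity passes on to smaller and smaller blocks, down to the `0 × 0` block, which has
determinant `1` (`IsWishart.not_ae_det_eq_zero`).
-/

open Matrix

/-! ### Bordered matrices and positive semidefinite matrices -/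

/-- The symmetric bordered matrix with corner `a`, border `y` and lower right block `C`. -/
def bordered {n : ℕ} (a : ℝ) (y : Fin n → ℝ) (C : Matrix (Fin n) (Fin n) ℝ) :
    Matrix (Fin (n + 1)) (Fin (n + 1)) ℝ :=
  Matrix.of (Fin.cons (Fin.cons a y) fun i => Fin.cons (y i) (C i))

section bordered

variable {n : ℕ} (a : ℝ) (y : Fin n → ℝ) (C : Matrix (Fin n) (Fin n) ℝ)

@[simp] lemma bordered_zero_zero : bordered a y C 0 0 = a := rfl
@[simp] lemma bordered_zero_succ (j : Fin n) : bordered a y C 0 j.succ = y j := rfl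
@[simp] lemma bordered_succ_zero (i : Fin n) : bordered a y C i.succ 0 = y i := rfl
@[simp] lemma bordered_succ_succ (i j : Fin n) : bordered a y C i.succ j.succ = C i j := rfl

lemma one_sub_bordered : 1 - bordered a y C = bordered (1 - a) (-y) (1 - C) := by
  ext i j
  refine Fin.cases ?_ (fun i => ?_) i <;> refine Fin.cases ?_ (fun j => ?_) j <;>
    simp [Matrix.one_apply, Fin.succ_ne_zero, (Fin.succ_ne_zero _).symm]

lemma smul_bordered (c : ℝ) : c • bordered a y C = bordered (c * a) (c • y) (c • C) := by
  ext i j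
  refine Fin.cases ?_ (fun i => ?_) i <;> refine Fin.cases ?_ (fun j => ?_) j <;> simp

variable {C} in
lemma isHermitian_bordered (hC : C.IsHermitian) : (bordered a y C).IsHermitian := by
  ext i j
  have := fun i j => hC.apply i j
  refine Fin.cases ?_ (fun i => ?_) i <;> refine Fin.cases ?_ (fun j => ?_) j <;> simp_all

lemma dotProduct_bordered_mulVec (x : Fin (n + 1) → ℝ) :
    x ⬝ᵥ (bordered a y C *ᵥ x) = a * x 0 ^ 2 + 2 * (x 0 * (y ⬝ᵥ Fin.tail x)) +
      Fin.tail x ⬝ᵥ (C *ᵥ Fin.tail x) := by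
  simp only [dotProduct, mulVec, Fin.sum_univ_succ, bordered_zero_zero, bordered_zero_succ,
    bordered_succ_zero, bordered_succ_succ, Fin.tail, mul_add, Finset.sum_add_distrib,
    Finset.mul_sum]
  have : ∑ i : Fin n, x i.succ * (y i * x 0) = ∑ i : Fin n, x 0 * (y i * x i.succ) :=
    Finset.sum_congr rfl fun i _ => by ring
  simp only [this, ← Finset.mul_sum]
  ring

lemma trace_bordered_mul {ξ : Matrix (Fin (n + 1)) (Fin (n + 1)) ℝ} (hξ : ξ.IsHermitian) :
    (bordered a y C * ξ).trace = a * ξ 0 0 + 2 * (y ⬝ᵥ fun i => ξ 0 i.succ) +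
      (C * ξ.submatrix Fin.succ Fin.succ).trace := by
  have h : ∀ i, ξ (Fin.succ i) 0 = ξ 0 i.succ := fun i => by simpa using hξ.apply 0 i.succ
  simp only [Matrix.trace, Matrix.diag, Matrix.mul_apply, Fin.sum_univ_succ, bordered_zero_zero,
    bordered_zero_succ, bordered_succ_zero, bordered_succ_succ, h, Finset.sum_add_distrib,
    dotProduct, submatrix_apply]
  ring

lemma bordered_eta {ξ : Matrix (Fin (n + 1)) (Fin (n + 1)) ℝ} (hξ : ξ.IsHermitian) :
    bordered (ξ 0 0) (fun i => ξ 0 i.succ) (ξ.submatrix Fin.succ Fin.succ) = ξ := by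
  have h : ∀ i, ξ 0 (Fin.succ i) = ξ i.succ 0 := fun i => by simpa using hξ.apply i.succ 0
  ext i j
  refine Fin.cases ?_ (fun i => ?_) i <;> refine Fin.cases ?_ (fun j => ?_) j <;> simp [h]

lemma det_bordered (hC : IsUnit C.det) :
    (bordered a y C).det = C.det * (a - y ⬝ᵥ (C⁻¹ *ᵥ y)) := by
  let e : Fin n ⊕ Unit ≃ Fin (n + 1) :=
    ((finSuccEquiv n).trans (Equiv.optionEquivSumPUnit _)).symm
  have h1 : (bordered a y C).submatrix e e =
      fromBlocks C (replicateCol Unit y) (replicateRow Unit y) (of fun _ _ => a) := by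
    ext i j
    rcases i with i | i <;> rcases j with j | j <;> simp [e]
  have := invertibleOfIsUnitDet C hC
  rw [← det_submatrix_equiv_self e, h1, det_fromBlocks₁₁, det_unique (n := Unit),
    invOf_eq_nonsing_inv]
  rw [Matrix.sub_apply, Matrix.mul_assoc, ← replicateCol_mulVec, of_apply]
  simp [Matrix.mul_apply, dotProduct]

lemma posSemidef_bordered_zero (hC : C.PosSemidef) : (bordered 0 0 C).PosSemidef := by
  refine .of_dotProduct_mulVec_nonneg (isHermitian_bordered _ _ hC.1) fun x => ?_
  simp only [star_trivial, dotProduct_bordered_mulVec]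
  simpa using hC.dotProduct_mulVec_nonneg (Fin.tail x)

end bordered

lemma dotProduct_mulVec_eq_trace {n : ℕ} (v w : Fin n → ℝ) (M : Matrix (Fin n) (Fin n) ℝ) :
    v ⬝ᵥ (M *ᵥ w) = (vecMulVec w v * M).trace := by
  simp only [dotProduct, mulVec, Matrix.trace, Matrix.diag, Matrix.mul_apply, vecMulVec_apply,
    Finset.mul_sum]
  rw [Finset.sum_comm]
  exact Finset.sum_congr rfl fun i _ => Finset.sum_congr rfl fun j _ => by ring

lemma posSemidef_vecMulVec_self {n : ℕ} (v : Fin n → ℝ) : (vecMulVec v v).PosSemidef := by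
  simpa using posSemidef_vecMulVec_self_star v

open scoped MatrixOrder Matrix.Norms.L2Operator in
lemma exists_eq_transpose_mul_self {n : ℕ} {A : Matrix (Fin n) (Fin n) ℝ} (hA : A.PosSemidef) :
    ∃ S : Matrix (Fin n) (Fin n) ℝ, A = Sᵀ * S := by
  obtain ⟨S, hS⟩ := CStarAlgebra.nonneg_iff_eq_star_mul_self.mp hA.nonneg
  exact ⟨S, by rw [hS, star_eq_conjTranspose, conjTranspose_eq_transpose_of_trivial]⟩

lemma trace_mul_nonneg {n : ℕ} {A B : Matrix (Fin n) (Fin n) ℝ} (hA : A.PosSemidef)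
    (hB : B.PosSemidef) : 0 ≤ (A * B).trace := by
  obtain ⟨S, rfl⟩ := exists_eq_transpose_mul_self hA
  rw [Matrix.mul_assoc, trace_mul_comm]
  simpa using (hB.mul_mul_conjTranspose_same S).trace_nonneg

/-- Symmetric matrices that differ are told apart by a quadratic form. -/
lemma exists_dotProduct_mulVec_ne {n : ℕ} {A B : Matrix (Fin n) (Fin n) ℝ} (hA : A.IsHermitian)
    (hB : B.IsHermitian) (h : A ≠ B) : ∃ v, v ⬝ᵥ (A *ᵥ v) ≠ v ⬝ᵥ (B *ᵥ v) := by
  by_contra! H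
  apply h
  ext i j
  have e : ∀ (M : Matrix (Fin n) (Fin n) ℝ) (hM : M.IsHermitian) i j,
      M i j = ((Pi.single i 1 + Pi.single j 1) ⬝ᵥ (M *ᵥ (Pi.single i 1 + Pi.single j 1))
        - Pi.single i 1 ⬝ᵥ (M *ᵥ Pi.single i 1) - Pi.single j 1 ⬝ᵥ (M *ᵥ Pi.single j 1)) / 2 := by
    intro M hM i j
    have : M j i = M i j := by simpa using hM.apply i j
    simp [Matrix.mulVec_add, add_dotProduct]
    rw [this]; ring
  rw [e A hA, e B hB, H, H, H]

lemma one_sub_two_smul_posDef {n : ℕ} {u : Matrix (Fin n) (Fin n) ℝ}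
    (hu : (1 - (2 : ℝ) • u).PosSemidef) : (1 - u).PosDef := by
  have h1 : ((1 / 2 : ℝ) • (1 : Matrix (Fin n) (Fin n) ℝ)).PosDef :=
    Matrix.PosDef.one.smul (by norm_num)
  have h2 := h1.add_posSemidef (hu.smul (show (0 : ℝ) ≤ 1 / 2 by norm_num))
  convert h2 using 1
  rw [smul_sub, smul_smul]
  ext i j
  simp
  ring

lemma one_sub_posDef {n : ℕ} {u : Matrix (Fin n) (Fin n) ℝ}
    (hu : (-u).PosSemidef) : (1 - u).PosDef := by
  simpa [sub_eq_add_neg] using Matrix.PosDef.one.add_posSemidef hu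

/-! ### Uniqueness of the Laplace transform -/

instance PSDCone.polishSpace (d : ℕ) : PolishSpace (PSDCone d) := by
  have : PolishSpace (Matrix (Fin d) (Fin d) ℝ) :=
    inferInstanceAs (PolishSpace (Fin d → Fin d → ℝ))
  have hc : IsClosed {A : Matrix (Fin d) (Fin d) ℝ | A.PosSemidef} := by
    have : {A : Matrix (Fin d) (Fin d) ℝ | A.PosSemidef} =
        {A | Aᵀ = A} ∩ ⋂ x : Fin d → ℝ, {A | 0 ≤ x ⬝ᵥ (A *ᵥ x)} := by
      ext A
      simp [posSemidef_iff_dotProduct_mulVec, IsHermitian]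
    rw [this]
    exact (isClosed_eq (by fun_prop) (by fun_prop)).inter <|
      isClosed_iInter fun x => isClosed_le (by fun_prop) (by fun_prop)
  exact hc.polishSpace

@[fun_prop]
lemma PSDCone.continuous_val {d : ℕ} : Continuous fun ξ : PSDCone d => ξ.val :=
  continuous_subtype_val

lemma PSDCone.continuous_trace_mul {d : ℕ} (u : Matrix (Fin d) (Fin d) ℝ) :
    Continuous fun ξ : PSDCone d => (u * ξ.val).trace := by
  fun_prop

lemma PSDCone.trace_mul_nonpos {d : ℕ} {u : Matrix (Fin d) (Fin d) ℝ} (hu : (-u).PosSemidef)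
    (ξ : PSDCone d) : (u * ξ.val).trace ≤ 0 := by
  have := trace_mul_nonneg hu ξ.2
  simpa using this

open BoundedContinuousFunction in
/-- The bounded continuous function `ξ ↦ exp (tr (u ξ))` on `S_d^+`, for `u ∈ -S_d^+`. -/
noncomputable def expTrace {d : ℕ} (u : Matrix (Fin d) (Fin d) ℝ) (hu : (-u).PosSemidef) :
    PSDCone d →ᵇ ℝ :=
  BoundedContinuousFunction.ofNormedAddCommGroup (fun ξ => Real.exp (u * ξ.val).trace)
    (Real.continuous_exp.comp (PSDCone.continuous_trace_mul u)) 1 fun ξ => by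
      simpa using PSDCone.trace_mul_nonpos hu ξ

open BoundedContinuousFunction in
/-- The functions `exp (tr (u ξ))`, which are closed under products and separate points, span an
algebra to which the Stone–Weierstrass theorem for finite measures applies. -/
theorem ext_of_laplaceTransform {d : ℕ} {μ ν : Measure (PSDCone d)} [IsFiniteMeasure μ]
    [IsFiniteMeasure ν]
    (h : ∀ u : Matrix (Fin d) (Fin d) ℝ, (-u).PosSemidef →
      laplaceTransform μ u = laplaceTransform ν u) : μ = ν := by
  let S : Submonoid (PSDCone d →ᵇ ℝ) :=
    { carrier := {f | ∃ u hu, f = expTrace u hu}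
      one_mem' := ⟨0, by simpa using PosSemidef.zero, by ext; simp [expTrace]⟩
      mul_mem' := by
        rintro _ _ ⟨u, hu, rfl⟩ ⟨v, hv, rfl⟩
        refine ⟨u + v, by simpa [add_comm] using hu.add hv, ?_⟩
        ext ξ
        simp [expTrace, Matrix.add_mul, Real.exp_add] }
  let A : StarSubalgebra ℝ (PSDCone d →ᵇ ℝ) :=
    { Algebra.adjoin ℝ (S : Set (PSDCone d →ᵇ ℝ)) with
      star_mem' := fun {a} ha => by
        have : star a = a := by ext; simp
        rw [this]; exact ha }
  have hmem : ∀ f ∈ A, f ∈ Submodule.span ℝ (S : Set (PSDCone d →ᵇ ℝ)) := by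
    intro f hf
    have : f ∈ Subalgebra.toSubmodule (Algebra.adjoin ℝ (S : Set (PSDCone d →ᵇ ℝ))) := hf
    rwa [Algebra.adjoin_eq_span_of_subset] at this
    intro x hx
    rw [Submonoid.closure_eq] at hx
    exact Submodule.subset_span hx
  refine ext_of_forall_mem_subalgebra_integral_eq_of_polish (𝕜 := ℝ) (A := A) ?_ ?_
  · intro ξ η hne
    obtain ⟨v, hv⟩ := exists_dotProduct_mulVec_ne ξ.2.1 η.2.1 (fun H => hne (Subtype.ext H))
    have hu : (-(-vecMulVec v v)).PosSemidef := by
      simpa using posSemidef_vecMulVec_self v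
    refine ⟨_, ⟨_, ⟨expTrace _ hu, Algebra.subset_adjoin ⟨_, hu, rfl⟩, rfl⟩, rfl⟩, ?_⟩
    simpa [expTrace, dotProduct_mulVec_eq_trace] using hv
  · intro g hg
    have hg' := hmem g hg
    clear hg
    induction hg' using Submodule.span_induction with
    | mem x hx =>
      obtain ⟨u, hu, rfl⟩ := hx
      exact h u hu
    | zero => simp
    | add x y _ _ hx hy =>
      have h1 : ∀ ρ : Measure (PSDCone d), IsFiniteMeasure ρ →
          ∫ ξ, (x + y) ξ ∂ρ = ∫ ξ, x ξ ∂ρ + ∫ ξ, y ξ ∂ρ := fun ρ _ =>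
        integral_add (x.integrable ρ) (y.integrable ρ)
      rw [h1 μ ‹_›, h1 ν ‹_›, hx, hy]
    | smul a x _ hx => simp [integral_const_mul, hx]

/-- Finite measures with densities `g₁` and `g₂`, pushed forward along `π`, agree as soon as
their Laplace transforms do. -/
theorem integral_mul_comp_eq_of_laplace {Ω : Type*} [MeasurableSpace Ω] {ν : Measure Ω} {d : ℕ}
    {π : Ω → PSDCone d} (hπ : Measurable π) {g₁ g₂ : Ω → ℝ} (hg₁ : Integrable g₁ ν)
    (hg₂ : Integrable g₂ ν) (hm₁ : Measurable g₁) (hm₂ : Measurable g₂)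
    (h₁ : 0 ≤ g₁) (h₂ : 0 ≤ g₂)
    (h : ∀ u : Matrix (Fin d) (Fin d) ℝ, (-u).PosSemidef →
      ∫ ω, g₁ ω * Real.exp (u * (π ω).val).trace ∂ν =
        ∫ ω, g₂ ω * Real.exp (u * (π ω).val).trace ∂ν)
    {f : PSDCone d → ℝ} (hf : Measurable f) :
    ∫ ω, g₁ ω * f (π ω) ∂ν = ∫ ω, g₂ ω * f (π ω) ∂ν := by
  have key : ∀ {g : Ω → ℝ}, Measurable g → 0 ≤ g → ∀ {f : PSDCone d → ℝ}, Measurable f →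
      ∫ ξ, f ξ ∂((ν.withDensity fun ω => ENNReal.ofReal (g ω)).map π) =
        ∫ ω, g ω * f (π ω) ∂ν := by
    intro g hm h0 f hf
    rw [integral_map hπ.aemeasurable hf.aestronglyMeasurable,
      integral_withDensity_eq_integral_toReal_smul hm.ennreal_ofReal (by simp)]
    simp [ENNReal.toReal_ofReal (h0 _)]
  have : IsFiniteMeasure (ν.withDensity fun ω => ENNReal.ofReal (g₁ ω)) :=
    isFiniteMeasure_withDensity_ofReal hg₁.2
  have : IsFiniteMeasure (ν.withDensity fun ω => ENNReal.ofReal (g₂ ω)) :=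
    isFiniteMeasure_withDensity_ofReal hg₂.2
  rw [← key hm₁ h₁ hf, ← key hm₂ h₂ hf]
  congr 1
  refine ext_of_laplaceTransform fun u hu => ?_
  have hmeas : Measurable fun ξ : PSDCone d => Real.exp (u * ξ.val).trace :=
    (Real.continuous_exp.comp (PSDCone.continuous_trace_mul u)).measurable
  rw [laplaceTransform, laplaceTransform, key hm₁ h₁ hmeas, key hm₂ h₂ hmeas]
  exact h u hu

/-! ### Gaussian and gamma integrals -/

lemma integral_exp_neg_dotProduct_self (n : ℕ) :
    ∫ x : Fin n → ℝ, Real.exp (-(x ⬝ᵥ x)) = √Real.pi ^ n := by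
  have h : ∀ x : Fin n → ℝ, Real.exp (-(x ⬝ᵥ x)) = ∏ i, Real.exp (-1 * x i ^ 2) := by
    intro x
    rw [← Real.exp_sum]
    simp [dotProduct, sq]
  simp_rw [h]
  rw [integral_fintype_prod_volume_eq_pow (fun t : ℝ => Real.exp (-1 * t ^ 2)), integral_gaussian]
  simp

/-- Completing the square after the substitution `z = S x`, where `M = Sᵀ S`. -/
theorem integral_exp_linear_sub_quadratic {n : ℕ} {M : Matrix (Fin n) (Fin n) ℝ} (hM : M.PosDef)
    (b : Fin n → ℝ) :
    ∫ x : Fin n → ℝ, Real.exp (2 * (b ⬝ᵥ x) - x ⬝ᵥ (M *ᵥ x)) =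
      √Real.pi ^ n * (M.det ^ (-(1 / 2 : ℝ)) * Real.exp (b ⬝ᵥ (M⁻¹ *ᵥ b))) := by
  obtain ⟨S, rfl⟩ := exists_eq_transpose_mul_self hM.posSemidef
  have hdet : (Sᵀ * S).det = S.det ^ 2 := by rw [det_mul, det_transpose, sq]
  have hS : S.det ≠ 0 := by
    intro h
    have := hM.det_pos
    rw [hdet, h] at this
    simp at this
  have hSu : IsUnit S.det := hS.isUnit
  have hSt : IsUnit Sᵀ.det := by rwa [det_transpose]
  set c : Fin n → ℝ := (Sᵀ)⁻¹ *ᵥ b with hc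
  have hb : Sᵀ *ᵥ c = b := by rw [hc, mulVec_mulVec, mul_nonsing_inv _ hSt, one_mulVec]
  have hcc : c ⬝ᵥ c = b ⬝ᵥ ((Sᵀ * S)⁻¹ *ᵥ b) := by
    rw [Matrix.mul_inv_rev, ← mulVec_mulVec, ← hc, dotProduct_mulVec, ← mulVec_transpose,
      transpose_nonsing_inv, transpose_transpose, dotProduct_comm]
  have hsq : ∀ x, 2 * (b ⬝ᵥ x) - x ⬝ᵥ ((Sᵀ * S) *ᵥ x) =
      c ⬝ᵥ c + -((S *ᵥ x - c) ⬝ᵥ (S *ᵥ x - c)) := by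
    intro x
    have h1 : b ⬝ᵥ x = c ⬝ᵥ (S *ᵥ x) := by
      rw [← hb, mulVec_transpose, dotProduct_mulVec]
    have h2 : x ⬝ᵥ ((Sᵀ * S) *ᵥ x) = (S *ᵥ x) ⬝ᵥ (S *ᵥ x) := by
      rw [← mulVec_mulVec, dotProduct_mulVec, vecMul_transpose]
    rw [h1, h2, sub_dotProduct, dotProduct_sub, dotProduct_sub, dotProduct_comm (S *ᵥ x) c]
    ring
  have hmeas : Continuous fun z : Fin n → ℝ => Real.exp (c ⬝ᵥ c + -((z - c) ⬝ᵥ (z - c))) := by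
    fun_prop
  have hmap := integral_map (μ := (volume : Measure (Fin n → ℝ)))
    (φ := Matrix.toLin' S) (by fun_prop) hmeas.aestronglyMeasurable
  rw [Real.map_matrix_volume_pi_eq_smul_volume_pi hS, integral_smul_measure] at hmap
  simp only [toLin'_apply] at hmap
  simp_rw [hsq]
  rw [← hmap]
  simp_rw [Real.exp_add]
  rw [integral_const_mul, integral_sub_right_eq_self fun z : Fin n → ℝ => Real.exp (-(z ⬝ᵥ z)),
    integral_exp_neg_dotProduct_self, hcc, hdet, ENNReal.toReal_ofReal (abs_nonneg _), smul_eq_mul,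
    Real.rpow_neg (sq_nonneg _), ← Real.sqrt_eq_rpow, Real.sqrt_sq_eq_abs, abs_inv]
  ring

/-- The centred Gaussian measure on `ℝⁿ` with covariance matrix `I / 2`. -/
noncomputable def halfGaussian (n : ℕ) : Measure (Fin n → ℝ) :=
  volume.withDensity fun x => ENNReal.ofReal ((√Real.pi ^ n)⁻¹ * Real.exp (-(x ⬝ᵥ x)))

lemma integral_halfGaussian {n : ℕ} (f : (Fin n → ℝ) → ℝ) :
    ∫ x, f x ∂(halfGaussian n) =
      (√Real.pi ^ n)⁻¹ * ∫ x, Real.exp (-(x ⬝ᵥ x)) * f x := by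
  rw [halfGaussian, integral_withDensity_eq_integral_toReal_smul (by fun_prop)
    (.of_forall fun _ => ENNReal.ofReal_lt_top), ← integral_const_mul]
  refine integral_congr_ae (.of_forall fun x => ?_)
  simp only
  rw [ENNReal.toReal_ofReal (by positivity), smul_eq_mul, mul_assoc]

instance (n : ℕ) : IsProbabilityMeasure (halfGaussian n) := by
  have hpi : √Real.pi ^ n ≠ 0 := by positivity
  have hint : Integrable fun x : Fin n → ℝ => Real.exp (-(x ⬝ᵥ x)) :=
    .of_integral_ne_zero (by rw [integral_exp_neg_dotProduct_self]; exact hpi)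
  constructor
  rw [halfGaussian, withDensity_apply _ MeasurableSet.univ, Measure.restrict_univ,
    ← ofReal_integral_eq_lintegral_ofReal (hint.const_mul _) (.of_forall fun x => by positivity),
    integral_const_mul, integral_exp_neg_dotProduct_self, inv_mul_cancel₀ hpi, ENNReal.ofReal_one]

lemma integral_exp_halfGaussian {n : ℕ} {C : Matrix (Fin n) (Fin n) ℝ} (hC : (1 - C).PosDef)
    (b : Fin n → ℝ) :
    ∫ x, Real.exp (2 * (b ⬝ᵥ x) + x ⬝ᵥ (C *ᵥ x)) ∂(halfGaussian n) =
      (1 - C).det ^ (-(1 / 2 : ℝ)) * Real.exp (b ⬝ᵥ ((1 - C)⁻¹ *ᵥ b)) := by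
  have hpi : √Real.pi ^ n ≠ 0 := by positivity
  rw [integral_halfGaussian, ← inv_mul_cancel_left₀ hpi (_ * Real.exp _),
    ← integral_exp_linear_sub_quadratic hC]
  congr 1
  refine integral_congr_ae (.of_forall fun x => ?_)
  simp only [← Real.exp_add, sub_mulVec, one_mulVec, dotProduct_sub]
  congr 1
  ring

lemma measurable_gammaPDF (p r : ℝ) : Measurable (ProbabilityTheory.gammaPDF p r) :=
  (ProbabilityTheory.measurable_gammaPDFReal p r).ennreal_ofReal

lemma integral_exp_mul_gammaMeasure {p c : ℝ} (hp : 0 < p) (hc : c < 1) :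
    ∫ g, Real.exp (c * g) ∂(ProbabilityTheory.gammaMeasure p 1) = (1 - c) ^ (-p) := by
  have hc' : 0 < 1 - c := by linarith
  rw [ProbabilityTheory.gammaMeasure, integral_withDensity_eq_integral_toReal_smul
    (measurable_gammaPDF p 1)
    (.of_forall fun x => by simp [ProbabilityTheory.gammaPDF])]
  have h : ∀ x : ℝ, (ProbabilityTheory.gammaPDF p 1 x).toReal • Real.exp (c * x) =
      (Set.Ici (0 : ℝ)).indicator
        (fun x => (Real.Gamma p)⁻¹ * (x ^ (p - 1) * Real.exp (-((1 - c) * x)))) x := by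
    intro x
    rw [ProbabilityTheory.gammaPDF,
      ENNReal.toReal_ofReal (ProbabilityTheory.gammaPDFReal_nonneg hp one_pos x),
      ProbabilityTheory.gammaPDFReal]
    by_cases hx : 0 ≤ x
    · rw [if_pos hx, Set.indicator_of_mem (Set.mem_Ici.2 hx),
        show -((1 - c) * x) = -(1 * x) + c * x by ring, Real.exp_add]
      simp
      ring
    · rw [if_neg hx, Set.indicator_of_notMem (by simpa using hx)]
      simp
  simp_rw [h]
  rw [integral_indicator measurableSet_Ici, integral_Ici_eq_integral_Ioi, integral_const_mul,
    Real.integral_rpow_mul_exp_neg_mul_Ioi hp hc', Real.rpow_neg hc'.le, one_div,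
    Real.inv_rpow hc'.le]
  have := (Real.Gamma_pos_of_pos hp).ne'
  field_simp

lemma ae_nonneg_gammaMeasure (p r : ℝ) : ∀ᵐ g ∂(ProbabilityTheory.gammaMeasure p r), 0 ≤ g := by
  rw [ProbabilityTheory.gammaMeasure, ae_withDensity_iff
    (measurable_gammaPDF p r)]
  refine .of_forall fun x hx => ?_
  by_contra h
  exact hx (ProbabilityTheory.gammaPDF_of_neg (not_le.1 h))

/-! ### Construction of the Wishart distributions -/

/-- The Schur complement factorization of the Laplace transform. -/
lemma det_one_sub_bordered {n : ℕ} {a : ℝ} {y : Fin n → ℝ} {C : Matrix (Fin n) (Fin n) ℝ}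
    (hC : (1 - C).PosDef) :
    (1 - bordered a y C).det = (1 - C).det * (1 - (a + y ⬝ᵥ ((1 - C)⁻¹ *ᵥ y))) := by
  rw [one_sub_bordered, det_bordered _ _ _ hC.det_pos.ne'.isUnit]
  simp [mulVec_neg]
  ring_nf
  simp

lemma bordered_rank_one {n : ℕ} (t : ℝ) (x : Fin n → ℝ) (C : Matrix (Fin n) (Fin n) ℝ) :
    bordered (t * t) (t • x) (vecMulVec x x + C) =
      vecMulVec (Fin.cons t x) (Fin.cons t x) + bordered 0 0 C := by
  ext i j
  refine Fin.cases ?_ (fun i => ?_) i <;> refine Fin.cases ?_ (fun j => ?_) j <;>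
    simp [vecMulVec_apply, mul_comm]

/-- One step of the Bartlett decomposition: `(g, x, ξ)` is sent to
`(√g, x) (√g, x)ᵀ + 0 ⊕ ξ`. The junk value `√g = 0` for `g < 0` is harmless, as `g` will be gamma
distributed. -/
noncomputable def bartlett {n : ℕ} (z : ℝ × (Fin n → ℝ) × PSDCone n) : PSDCone (n + 1) :=
  ⟨bordered (√z.1 * √z.1) (√z.1 • z.2.1) (vecMulVec z.2.1 z.2.1 + z.2.2.val), by
    rw [bordered_rank_one]
    exact (posSemidef_vecMulVec_self _).add (posSemidef_bordered_zero _ z.2.2.2)⟩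

lemma measurable_bartlett {n : ℕ} : Measurable (bartlett (n := n)) := by
  refine Continuous.measurable (Continuous.subtype_mk (continuous_matrix fun i j => ?_) _)
  have h : ∀ i j, Continuous fun z : ℝ × (Fin n → ℝ) × PSDCone n => z.2.2.val i j := fun i j =>
    (PSDCone.continuous_val.comp (continuous_snd.comp continuous_snd)).matrix_elem i j
  refine Fin.cases ?_ (fun i => ?_) i <;> refine Fin.cases ?_ (fun j => ?_) j <;>
    simp only [bordered_zero_zero, bordered_zero_succ, bordered_succ_zero, bordered_succ_succ,
      Matrix.add_apply, vecMulVec_apply, Pi.smul_apply, smul_eq_mul]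
  · fun_prop
  · fun_prop
  · fun_prop
  · exact Continuous.add (by fun_prop) (h i j)

lemma trace_bordered_mul_bartlett {n : ℕ} (a : ℝ) (y : Fin n → ℝ) (C : Matrix (Fin n) (Fin n) ℝ)
    (z : ℝ × (Fin n → ℝ) × PSDCone n) :
    (bordered a y C * (bartlett z).val).trace = a * (√z.1 * √z.1) +
      ((2 * ((√z.1 • y) ⬝ᵥ z.2.1) + z.2.1 ⬝ᵥ (C *ᵥ z.2.1)) + (C * z.2.2.val).trace) := by
  rw [trace_bordered_mul _ _ _ (bartlett z).2.1]
  have h1 : (bartlett z).val.submatrix Fin.succ Fin.succ = vecMulVec z.2.1 z.2.1 + z.2.2.val := rfl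
  have h2 : (fun i : Fin n => (bartlett z).val 0 i.succ) = √z.1 • z.2.1 := rfl
  have h3 : (bartlett z).val 0 0 = √z.1 * √z.1 := rfl
  rw [h1, h2, h3, Matrix.mul_add, trace_add, trace_mul_comm, ← dotProduct_mulVec_eq_trace]
  simp only [dotProduct_smul, smul_dotProduct]
  ring

/-- `p` is the shape parameter of a Wishart distribution on `S_n^+` with scale matrix `I`. -/
def HasWishart (n : ℕ) (p : ℝ) : Prop :=
  ∃ μ : Measure (PSDCone n), IsProbabilityMeasure μ ∧
    ∀ u : Matrix (Fin n) (Fin n) ℝ, (-u).PosSemidef → laplaceTransform μ u = (1 - u).det ^ (-p)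

lemma laplaceTransform_dirac_origin {n : ℕ} (u : Matrix (Fin n) (Fin n) ℝ) :
    laplaceTransform (Measure.dirac (PSDCone.origin n)) u = 1 := by
  simp [laplaceTransform, PSDCone.origin]

lemma hasWishart_zero_right (n : ℕ) : HasWishart n 0 :=
  ⟨.dirac (PSDCone.origin n), inferInstance, fun u _ => by simp [laplaceTransform_dirac_origin]⟩

lemma hasWishart_zero_left (p : ℝ) : HasWishart 0 p :=
  ⟨.dirac (PSDCone.origin 0), inferInstance, fun u _ => by simp [laplaceTransform_dirac_origin]⟩

theorem HasWishart.succ {n : ℕ} {p : ℝ} (hp : 0 < p) (h : HasWishart n (p - 1 / 2)) :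
    HasWishart (n + 1) p := by
  obtain ⟨μ, hμ, hL⟩ := h
  have := ProbabilityTheory.isProbabilityMeasure_gammaMeasure hp one_pos
  set γ := ProbabilityTheory.gammaMeasure p 1
  refine ⟨(γ.prod ((halfGaussian n).prod μ)).map bartlett,
    Measure.isProbabilityMeasure_map measurable_bartlett.aemeasurable, fun u hu => ?_⟩
  set a := u 0 0
  set y : Fin n → ℝ := fun i => u 0 i.succ
  set C := u.submatrix Fin.succ Fin.succ
  have hu' : u = bordered a y C := (bordered_eta (by simpa using hu.1.neg)).symm
  have hC : (-C).PosSemidef := hu.submatrix Fin.succ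
  have hC1 := one_sub_posDef hC
  set c := a + y ⬝ᵥ ((1 - C)⁻¹ *ᵥ y) with hc_def
  have hdet : (1 - u).det = (1 - C).det * (1 - c) := by rw [hu', det_one_sub_bordered hC1]
  have hc : c < 1 := by
    have := (one_sub_posDef hu).det_pos
    rw [hdet] at this
    linarith [(pos_iff_pos_of_mul_pos this).1 hC1.det_pos]
  have hmeas : Measurable fun ξ : PSDCone (n + 1) => Real.exp (u * ξ.val).trace :=
    (Real.continuous_exp.comp (PSDCone.continuous_trace_mul u)).measurable
  have hint : Integrable (fun z => Real.exp (u * (bartlett z).val).trace)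
      (γ.prod ((halfGaussian n).prod μ)) := by
    refine Integrable.of_bound (hmeas.comp measurable_bartlett).aestronglyMeasurable 1
      (.of_forall fun z => ?_)
    simpa using PSDCone.trace_mul_nonpos hu (bartlett z)
  rw [laplaceTransform, integral_map measurable_bartlett.aemeasurable hmeas.aestronglyMeasurable,
    integral_prod _ hint]
  -- For fixed `g` the Gaussian integral supplies the missing factor `det (1 - C) ^ (-1 / 2)` and
  -- turns the cross term `2 √g y ⬝ x` into the summand `y ⬝ (1 - C)⁻¹ y` of `c`.
  have hinner : ∀ g, 0 ≤ g → ∫ w, Real.exp (u * (bartlett (g, w)).val).trace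
      ∂((halfGaussian n).prod μ) = (1 - C).det ^ (-p) * Real.exp (c * g) := by
    intro g hg
    simp_rw [hu', trace_bordered_mul_bartlett, Real.exp_add]
    rw [integral_const_mul]
    simp_rw [← Real.exp_add (2 * _)]
    rw [integral_prod_mul (fun x : Fin n → ℝ => Real.exp (2 * ((√g • y) ⬝ᵥ x) + x ⬝ᵥ (C *ᵥ x)))
      (fun ξ : PSDCone n => Real.exp (C * ξ.val).trace), integral_exp_halfGaussian hC1]
    have h2 := hL C hC
    rw [laplaceTransform] at h2
    rw [h2, show -p = -(1 / 2) + -(p - 1 / 2) by ring, Real.rpow_add hC1.det_pos, hc_def, add_mul,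
      Real.exp_add, mulVec_smul, dotProduct_smul, smul_dotProduct, smul_eq_mul, smul_eq_mul,
      ← mul_assoc (√g), Real.mul_self_sqrt hg, mul_comm g]
    ring
  rw [integral_congr_ae ((ae_nonneg_gammaMeasure p 1).mono fun g hg => hinner g hg),
    integral_const_mul, integral_exp_mul_gammaMeasure hp hc, hdet,
    Real.mul_rpow hC1.det_pos.le (by linarith)]

theorem hasWishart_of_mem {n : ℕ} {p : ℝ} (h : (∃ j : ℕ, p = j / 2) ∨ ((n : ℝ) - 1) / 2 ≤ p) :
    HasWishart n p := by
  induction n generalizing p with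
  | zero => exact hasWishart_zero_left p
  | succ n ih =>
    have hp : 0 ≤ p := by
      rcases h with ⟨j, rfl⟩ | h
      · positivity
      · push_cast at h
        have : (0 : ℝ) ≤ n := n.cast_nonneg
        linarith
    rcases hp.eq_or_lt with rfl | hp
    · exact hasWishart_zero_right _
    refine HasWishart.succ hp (ih ?_)
    rcases h with ⟨j, rfl⟩ | h
    · left
      rcases j with _ | j
      · simp at hp
      · exact ⟨j, by push_cast; ring⟩
    · right
      push_cast at h
      linarith

/-! ### Wishart distributions with exponential moments -/

/-- The Laplace transform of `ν` is `det (1 - u) ^ (-p)`, not only for `u ∈ -S_n^+` but for all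
symmetric `u ≤ 1 / 2`; so `ν` has exponential moments in every direction. -/
def IsWishart (n : ℕ) (p : ℝ) (ν : Measure (PSDCone n)) : Prop :=
  ∀ u : Matrix (Fin n) (Fin n) ℝ, (1 - (2 : ℝ) • u).PosSemidef →
    laplaceTransform ν u = (1 - u).det ^ (-p)

namespace IsWishart

variable {n : ℕ} {p : ℝ}

lemma integrable_exp {ν : Measure (PSDCone n)} (h : IsWishart n p ν)
    {u : Matrix (Fin n) (Fin n) ℝ} (hu : (1 - (2 : ℝ) • u).PosSemidef) :
    Integrable (fun ξ : PSDCone n => Real.exp (u * ξ.val).trace) ν := by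
  refine .of_integral_ne_zero ?_
  have := h u hu
  rw [laplaceTransform] at this
  rw [this]
  exact (Real.rpow_pos_of_pos (one_sub_two_smul_posDef hu).det_pos _).ne'

lemma isProbabilityMeasure {ν : Measure (PSDCone n)} (h : IsWishart n p ν) :
    IsProbabilityMeasure ν := by
  have := h 0 (by simpa using PosSemidef.one)
  simp only [laplaceTransform, Matrix.zero_mul, trace_zero, Real.exp_zero, integral_const,
    smul_eq_mul, mul_one, sub_zero, det_one, Real.one_rpow] at this
  exact ⟨by rwa [Measure.real, ENNReal.toReal_eq_one_iff] at this⟩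

end IsWishart

/-- Multiplication by `2` on `S_n^+`. -/
def doubling {n : ℕ} (ξ : PSDCone n) : PSDCone n := ⟨(2 : ℝ) • ξ.val, ξ.2.smul (by norm_num)⟩

lemma measurable_doubling {n : ℕ} : Measurable (doubling (n := n)) :=
  Continuous.measurable (Continuous.subtype_mk (by fun_prop) _)

/-- Tilting by `exp (-tr ξ)` and rescaling by `2` reproduces the Wishart Laplace transform on a
larger domain. -/
theorem isWishart_of_laplaceTransform {n : ℕ} {p : ℝ} {μ : Measure (PSDCone n)}
    (h : ∀ u : Matrix (Fin n) (Fin n) ℝ, (-u).PosSemidef →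
      laplaceTransform μ u = (1 - u).det ^ (-p)) :
    IsWishart n p ((μ.withDensity fun ξ =>
      ENNReal.ofReal (((2 : ℝ) ^ n) ^ p * Real.exp (-ξ.val.trace))).map doubling) := by
  intro u hu
  have hmeas : Measurable fun ξ : PSDCone n => Real.exp (u * ξ.val).trace :=
    (Real.continuous_exp.comp (PSDCone.continuous_trace_mul u)).measurable
  have hd : Continuous fun ξ : PSDCone n => ((2 : ℝ) ^ n) ^ p * Real.exp (-ξ.val.trace) := by
    fun_prop
  rw [laplaceTransform, integral_map measurable_doubling.aemeasurable hmeas.aestronglyMeasurable,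
    integral_withDensity_eq_integral_toReal_smul hd.measurable.ennreal_ofReal
    (.of_forall fun _ => ENNReal.ofReal_lt_top)]
  have hneg : (-((2 : ℝ) • u - 1)).PosSemidef := by simpa using hu
  have h1 : ∀ ξ : PSDCone n,
      (ENNReal.ofReal (((2 : ℝ) ^ n) ^ p * Real.exp (-ξ.val.trace))).toReal •
        Real.exp (u * (doubling ξ).val).trace =
      ((2 : ℝ) ^ n) ^ p * Real.exp (((2 : ℝ) • u - 1) * ξ.val).trace := by
    intro ξ
    rw [ENNReal.toReal_ofReal (by positivity), smul_eq_mul, mul_assoc, ← Real.exp_add]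
    congr 2
    simp [doubling, Matrix.sub_mul]
    ring
  simp_rw [h1]
  have h2 := h _ hneg
  rw [laplaceTransform] at h2
  have h3 : (1 : Matrix (Fin n) (Fin n) ℝ) - ((2 : ℝ) • u - 1) = (2 : ℝ) • (1 - u) := by
    rw [smul_sub, two_smul ℝ (1 : Matrix (Fin n) (Fin n) ℝ)]
    abel
  have h4 := (one_sub_two_smul_posDef hu).det_pos
  rw [integral_const_mul, h2, h3, det_smul, Fintype.card_fin, Real.mul_rpow (by positivity) h4.le,
    ← mul_assoc, ← Real.rpow_add (by positivity)]
  simp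

/-- The lower right `n × n` block. -/
def lowerBlock {n : ℕ} (ξ : PSDCone (n + 1)) : PSDCone n :=
  ⟨ξ.val.submatrix Fin.succ Fin.succ, ξ.2.submatrix _⟩

lemma measurable_lowerBlock {n : ℕ} : Measurable (lowerBlock (n := n)) :=
  Continuous.measurable (Continuous.subtype_mk (by fun_prop) _)

lemma trace_bordered_mul_val {n : ℕ} (a : ℝ) (y : Fin n → ℝ) (C : Matrix (Fin n) (Fin n) ℝ)
    (ξ : PSDCone (n + 1)) :
    (bordered a y C * ξ.val).trace = a * ξ.val 0 0 + 2 * (y ⬝ᵥ fun i => ξ.val 0 i.succ) +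
      (C * (lowerBlock ξ).val).trace :=
  trace_bordered_mul _ _ _ ξ.2.1

lemma posSemidef_one_sub_bordered {n : ℕ} {a : ℝ} {C : Matrix (Fin n) (Fin n) ℝ} (ha : a ≤ 1 / 2)
    (hC : (1 - (2 : ℝ) • C).PosSemidef) : (1 - (2 : ℝ) • bordered a 0 C).PosSemidef := by
  rw [smul_bordered, one_sub_bordered]
  refine .of_dotProduct_mulVec_nonneg (isHermitian_bordered _ _ hC.1) fun x => ?_
  have := hC.dotProduct_mulVec_nonneg (Fin.tail x)
  simp only [star_trivial, dotProduct_bordered_mulVec] at this ⊢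
  have h2 : 0 ≤ (1 - 2 * a) * x 0 ^ 2 := mul_nonneg (by linarith) (sq_nonneg _)
  simpa using add_nonneg h2 this

lemma dotProduct_sq_le {n : ℕ} (v x : Fin n → ℝ) : (v ⬝ᵥ x) ^ 2 ≤ (v ⬝ᵥ v) * (x ⬝ᵥ x) := by
  simpa [dotProduct, sq] using Finset.sum_mul_sq_le_sq_mul_sq Finset.univ v x

lemma posSemidef_one_sub_bordered_border {n : ℕ} {s : ℝ} {v : Fin n → ℝ}
    {C : Matrix (Fin n) (Fin n) ℝ} (hs : 4 * s ^ 2 * (v ⬝ᵥ v) ≤ 1) (hC : (-C).PosSemidef) :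
    (1 - (2 : ℝ) • bordered 0 (s • v) C).PosSemidef := by
  have hC1 : (1 - (2 : ℝ) • C).IsHermitian :=
    isHermitian_one.sub (by simpa [IsHermitian] using hC.1)
  rw [smul_bordered, one_sub_bordered]
  refine .of_dotProduct_mulVec_nonneg (isHermitian_bordered _ _ hC1) fun x => ?_
  have h1 := hC.dotProduct_mulVec_nonneg (Fin.tail x)
  have h2 := dotProduct_sq_le v (Fin.tail x)
  have h3 : 0 ≤ Fin.tail x ⬝ᵥ Fin.tail x := by
    simpa using dotProduct_star_self_nonneg (Fin.tail x)
  simp only [star_trivial, dotProduct_bordered_mulVec, neg_mulVec, dotProduct_neg, sub_mulVec,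
    one_mulVec, dotProduct_sub, smul_mulVec, dotProduct_smul, neg_dotProduct, smul_dotProduct,
    smul_eq_mul] at h1 ⊢
  have h4 : 4 * s ^ 2 * (v ⬝ᵥ Fin.tail x) ^ 2 ≤ Fin.tail x ⬝ᵥ Fin.tail x := by
    calc _ ≤ 4 * s ^ 2 * ((v ⬝ᵥ v) * (Fin.tail x ⬝ᵥ Fin.tail x)) := by gcongr
      _ = (4 * s ^ 2 * (v ⬝ᵥ v)) * (Fin.tail x ⬝ᵥ Fin.tail x) := by ring
      _ ≤ _ := mul_le_of_le_one_left h3 hs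
  nlinarith [sq_nonneg (x 0 - 2 * s * (v ⬝ᵥ Fin.tail x))]

lemma posSemidef_one_sub_add_vecMulVec {n : ℕ} {s : ℝ} {v : Fin n → ℝ}
    {C : Matrix (Fin n) (Fin n) ℝ} (hs : 2 * |s| * (v ⬝ᵥ v) ≤ 1) (hC : (-C).PosSemidef) :
    (1 - (2 : ℝ) • (C + s • vecMulVec v v)).PosSemidef := by
  have hC1 : (1 - (2 : ℝ) • (C + s • vecMulVec v v)).IsHermitian := by
    have h1 : Cᵀ = C := by simpa [IsHermitian] using hC.1
    simp [IsHermitian, h1]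
  refine .of_dotProduct_mulVec_nonneg hC1 fun x => ?_
  have h1 := hC.dotProduct_mulVec_nonneg x
  have h2 := dotProduct_sq_le v x
  have h3 : 0 ≤ x ⬝ᵥ x := by simpa using dotProduct_star_self_nonneg x
  have h5 : x ⬝ᵥ (vecMulVec v v *ᵥ x) = (v ⬝ᵥ x) ^ 2 := by
    rw [vecMulVec_mulVec, op_smul_eq_smul, dotProduct_smul, dotProduct_comm x v, smul_eq_mul, sq]
  simp only [star_trivial, neg_mulVec, dotProduct_neg, sub_mulVec, add_mulVec, dotProduct_add,
    one_mulVec, dotProduct_sub, smul_mulVec, dotProduct_smul, smul_eq_mul, h5] at h1 ⊢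
  have h4 : 2 * (s * (v ⬝ᵥ x) ^ 2) ≤ x ⬝ᵥ x := by
    calc _ ≤ 2 * (|s| * (v ⬝ᵥ x) ^ 2) := by gcongr; exact le_abs_self s
      _ ≤ 2 * (|s| * ((v ⬝ᵥ v) * (x ⬝ᵥ x))) := by gcongr
      _ = (2 * |s| * (v ⬝ᵥ v)) * (x ⬝ᵥ x) := by ring
      _ ≤ _ := mul_le_of_le_one_left h3 hs
  linarith

lemma one_sub_two_smul_posSemidef {n : ℕ} {C : Matrix (Fin n) (Fin n) ℝ} (hC : (-C).PosSemidef) :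
    (1 - (2 : ℝ) • C).PosSemidef := by
  simpa using posSemidef_one_sub_add_vecMulVec (s := 0) (v := 0) (by simp) hC

/-- The lower block of a Wishart matrix is Wishart with the same shape parameter. -/
lemma IsWishart.map_lowerBlock {n : ℕ} {p : ℝ} {ν : Measure (PSDCone (n + 1))}
    (h : IsWishart (n + 1) p ν) : IsWishart n p (ν.map lowerBlock) := by
  intro u hu
  have hmeas : Measurable fun ξ : PSDCone n => Real.exp (u * ξ.val).trace :=
    (Real.continuous_exp.comp (PSDCone.continuous_trace_mul u)).measurable
  have h1 := h _ (posSemidef_one_sub_bordered (a := 0) (by norm_num) hu)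
  rw [det_one_sub_bordered (one_sub_two_smul_posDef hu)] at h1
  rw [laplaceTransform, integral_map measurable_lowerBlock.aemeasurable hmeas.aestronglyMeasurable]
  simpa [laplaceTransform, trace_bordered_mul_val] using h1

/-! ### Moments from the Laplace transform -/

section moments

open ProbabilityTheory Filter Topology

variable {Ω : Type*} [MeasurableSpace Ω] {ν : Measure Ω} {X Z : Ω → ℝ} {φ : ℝ → ℝ}

lemma integral_withDensity_exp (hZ : Measurable Z) (f : Ω → ℝ) :
    ∫ ω, f ω ∂(ν.withDensity fun ω => ENNReal.ofReal (Real.exp (Z ω))) =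
      ∫ ω, f ω * Real.exp (Z ω) ∂ν := by
  rw [integral_withDensity_eq_integral_toReal_smul (by fun_prop)
    (.of_forall fun _ => ENNReal.ofReal_lt_top)]
  refine integral_congr_ae (.of_forall fun ω => ?_)
  simp only
  rw [ENNReal.toReal_ofReal (Real.exp_pos _).le, smul_eq_mul, mul_comm]

lemma integrable_withDensity_exp (hZ : Measurable Z) (f : Ω → ℝ) :
    Integrable f (ν.withDensity fun ω => ENNReal.ofReal (Real.exp (Z ω))) ↔
      Integrable (fun ω => f ω * Real.exp (Z ω)) ν := by
  rw [integrable_withDensity_iff (by fun_prop) (.of_forall fun _ => ENNReal.ofReal_lt_top)]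
  simp only [ENNReal.toReal_ofReal (Real.exp_pos _).le]

lemma zero_mem_interior_integrableExpSet (hZ : Measurable Z)
    (hint : ∀ᶠ t in 𝓝 0, Integrable (fun ω => Real.exp (t * X ω + Z ω)) ν) :
    0 ∈ interior (integrableExpSet X
      (ν.withDensity fun ω => ENNReal.ofReal (Real.exp (Z ω)))) := by
  rw [mem_interior_iff_mem_nhds]
  filter_upwards [hint] with t ht
  rw [integrableExpSet, Set.mem_ofPred_eq, integrable_withDensity_exp hZ]
  simpa only [Real.exp_add] using ht

lemma integrable_pow_mul_exp (hZ : Measurable Z)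
    (hint : ∀ᶠ t in 𝓝 0, Integrable (fun ω => Real.exp (t * X ω + Z ω)) ν) (k : ℕ) :
    Integrable (fun ω => X ω ^ k * Real.exp (Z ω)) ν := by
  have := integrable_pow_of_mem_interior_integrableExpSet
    (zero_mem_interior_integrableExpSet hZ hint) k
  rwa [integrable_withDensity_exp hZ] at this

/-- If `t ↦ ∫ exp (t X + Z)` is `φ` near `0`, the derivatives of `φ` at `0` are the moments of `X`
weighted by `exp Z`. -/
lemma iteratedDeriv_eq_integral_pow_mul_exp (hZ : Measurable Z)
    (hint : ∀ᶠ t in 𝓝 0, Integrable (fun ω => Real.exp (t * X ω + Z ω)) ν)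
    (hφ : ∀ᶠ t in 𝓝 0, ∫ ω, Real.exp (t * X ω + Z ω) ∂ν = φ t) (k : ℕ) :
    iteratedDeriv k φ 0 = ∫ ω, X ω ^ k * Real.exp (Z ω) ∂ν := by
  rw [← integral_withDensity_exp hZ]
  refine Eq.trans ?_ (iteratedDeriv_mgf_zero (zero_mem_interior_integrableExpSet hZ hint) k)
  refine Filter.EventuallyEq.iteratedDeriv_eq k ?_
  filter_upwards [hφ] with t ht
  rw [mgf, integral_withDensity_exp hZ, ← ht]
  simp only [Real.exp_add]

end moments

lemma iteratedDeriv_one_mul_one_sub_rpow (K p q : ℝ) :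
    iteratedDeriv 1 (fun t : ℝ => K * (1 - t * q) ^ (-p)) 0 = p * (K * q) := by
  rw [iteratedDeriv_one]
  have h1 : HasDerivAt (fun t : ℝ => 1 - t * q) (-q) 0 := by
    simpa using ((hasDerivAt_id (0 : ℝ)).mul_const q).const_sub 1
  have h2 := (h1.rpow_const (p := -p) (by simp)).const_mul K
  rw [h2.deriv]
  simp
  ring

lemma iteratedDeriv_two_mul_one_sub_sq_rpow (K p q : ℝ) :
    iteratedDeriv 2 (fun t : ℝ => K * (1 - t ^ 2 * q) ^ (-p)) 0 = 2 * (p * (K * q)) := by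
  rw [iteratedDeriv_succ, iteratedDeriv_one]
  have hd : ∀ t : ℝ, HasDerivAt (fun t : ℝ => 1 - t ^ 2 * q) (-(2 * t * q)) t := fun t => by
    simpa using ((hasDerivAt_pow 2 t).mul_const q).const_sub 1
  have hpos : ∀ᶠ t : ℝ in nhds 0, 0 < 1 - t ^ 2 * q :=
    (hd 0).continuousAt.eventually_mem (Ioi_mem_nhds (by simp))
  have hE : deriv (fun t : ℝ => K * (1 - t ^ 2 * q) ^ (-p)) =ᶠ[nhds 0]
      fun t => t * (2 * (p * (K * q)) * (1 - t ^ 2 * q) ^ (-p - 1)) := by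
    filter_upwards [hpos] with t ht
    rw [(((hd t).rpow_const (p := -p) (.inl ht.ne')).const_mul K).deriv]
    ring
  rw [hE.deriv_eq]
  have h2 := (hasDerivAt_id (0 : ℝ)).mul
    (((hd 0).rpow_const (p := -p - 1) (by simp)).const_mul (2 * (p * (K * q))))
  have := h2.deriv
  simp at this
  simpa [Pi.mul_def] using this

/-! ### Conditional moments of the first row given the lower block -/

section conditional

open Filter Topology

variable {n : ℕ} {p : ℝ} {ν : Measure (PSDCone (n + 1))}

lemma measurable_trace_lowerBlock (C : Matrix (Fin n) (Fin n) ℝ) :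
    Measurable fun ξ : PSDCone (n + 1) => (C * (lowerBlock ξ).val).trace :=
  (PSDCone.continuous_trace_mul C).measurable.comp measurable_lowerBlock

lemma det_sub_smul_vecMulVec {M : Matrix (Fin n) (Fin n) ℝ} (hM : IsUnit M.det) (s : ℝ)
    (v : Fin n → ℝ) :
    (M - s • vecMulVec v v).det = M.det * (1 - s * (v ⬝ᵥ (M⁻¹ *ᵥ v))) := by
  have h1 : M - s • vecMulVec v v =
      M + replicateCol Unit ((-s) • v) * replicateRow Unit v := by
    rw [← vecMulVec_eq, smul_vecMulVec, neg_smul, sub_eq_add_neg]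
  rw [h1, det_add_replicateCol_mul_replicateRow hM, Matrix.mul_assoc, ← replicateCol_mulVec,
    det_unique (n := Unit)]
  have h2 : (replicateRow Unit v * replicateCol Unit (M⁻¹ *ᵥ (-s) • v)) default default =
      v ⬝ᵥ (M⁻¹ *ᵥ (-s) • v) := rfl
  rw [Matrix.add_apply, h2, mulVec_smul, dotProduct_smul, Matrix.one_apply_eq, smul_eq_mul]
  ring

lemma mul_rpow_of_mul_pos {a b : ℝ} (ha : 0 < a) (hab : 0 < a * b) (r : ℝ) :
    (a * b) ^ r = a ^ r * b ^ r :=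
  Real.mul_rpow ha.le ((pos_iff_pos_of_mul_pos hab).1 ha).le

/-- The Laplace transform along the corner entry; the integrals are against `exp (tr (C ξ'))`, with
`ξ'` the lower block. -/
lemma IsWishart.exp_corner (h : IsWishart (n + 1) p ν) {C : Matrix (Fin n) (Fin n) ℝ}
    (hC : (-C).PosSemidef) : ∀ᶠ t : ℝ in 𝓝 0,
    Integrable (fun ξ => Real.exp (t * ξ.val 0 0 + (C * (lowerBlock ξ).val).trace)) ν ∧
    ∫ ξ, Real.exp (t * ξ.val 0 0 + (C * (lowerBlock ξ).val).trace) ∂ν =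
      (1 - C).det ^ (-p) * (1 - t * 1) ^ (-p) := by
  have hC1 := one_sub_posDef hC
  filter_upwards [Iic_mem_nhds (show (0 : ℝ) < 1 / 2 by norm_num)] with t ht
  have hu := posSemidef_one_sub_bordered (a := t) ht (one_sub_two_smul_posSemidef hC)
  have hd := (one_sub_two_smul_posDef hu).det_pos
  have h1 := h.integrable_exp hu
  have h2 := h _ hu
  rw [det_one_sub_bordered hC1] at h2 hd
  rw [mul_rpow_of_mul_pos hC1.det_pos hd] at h2
  simp only [laplaceTransform, trace_bordered_mul_val, zero_dotProduct, mul_zero, add_zero,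
    mul_one] at h1 h2 ⊢
  exact ⟨h1, h2⟩

/-- The Laplace transform along the border. It depends on `t` through `t ^ 2` and is the function of
`IsWishart.exp_lowerBlock` at `t ^ 2`. -/
lemma IsWishart.exp_border (h : IsWishart (n + 1) p ν) {C : Matrix (Fin n) (Fin n) ℝ}
    (hC : (-C).PosSemidef) (v : Fin n → ℝ) : ∀ᶠ t : ℝ in 𝓝 0,
    Integrable (fun ξ => Real.exp (t * (2 * (v ⬝ᵥ fun i => ξ.val 0 i.succ)) +
      (C * (lowerBlock ξ).val).trace)) ν ∧
    ∫ ξ, Real.exp (t * (2 * (v ⬝ᵥ fun i => ξ.val 0 i.succ)) +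
      (C * (lowerBlock ξ).val).trace) ∂ν =
      (1 - C).det ^ (-p) * (1 - t ^ 2 * (v ⬝ᵥ ((1 - C)⁻¹ *ᵥ v))) ^ (-p) := by
  have hC1 := one_sub_posDef hC
  have hev : ∀ᶠ t : ℝ in 𝓝 0, 4 * t ^ 2 * (v ⬝ᵥ v) < 1 := by
    have : Continuous fun t : ℝ => 4 * t ^ 2 * (v ⬝ᵥ v) := by fun_prop
    exact this.continuousAt.eventually_mem (Iio_mem_nhds (by simp))
  filter_upwards [hev] with t ht
  have hu := posSemidef_one_sub_bordered_border ht.le hC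
  have hd := (one_sub_two_smul_posDef hu).det_pos
  have h1 := h.integrable_exp hu
  have h2 := h _ hu
  rw [det_one_sub_bordered hC1] at h2 hd
  rw [mul_rpow_of_mul_pos hC1.det_pos hd] at h2
  simp only [laplaceTransform, trace_bordered_mul_val, zero_mul, zero_add, smul_dotProduct,
    mulVec_smul, dotProduct_smul, smul_eq_mul, mul_left_comm 2 t, ← mul_assoc t t, ← sq]
    at h1 h2 ⊢
  exact ⟨h1, h2⟩

lemma IsWishart.exp_lowerBlock (h : IsWishart (n + 1) p ν) {C : Matrix (Fin n) (Fin n) ℝ}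
    (hC : (-C).PosSemidef) (v : Fin n → ℝ) : ∀ᶠ t : ℝ in 𝓝 0,
    Integrable (fun ξ => Real.exp (t * (v ⬝ᵥ ((lowerBlock ξ).val *ᵥ v)) +
      (C * (lowerBlock ξ).val).trace)) ν ∧
    ∫ ξ, Real.exp (t * (v ⬝ᵥ ((lowerBlock ξ).val *ᵥ v)) +
      (C * (lowerBlock ξ).val).trace) ∂ν =
      (1 - C).det ^ (-p) * (1 - t * (v ⬝ᵥ ((1 - C)⁻¹ *ᵥ v))) ^ (-p) := by
  have hC1 := one_sub_posDef hC
  have hev : ∀ᶠ t : ℝ in 𝓝 0, 2 * |t| * (v ⬝ᵥ v) < 1 := by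
    have : Continuous fun t : ℝ => 2 * |t| * (v ⬝ᵥ v) := by fun_prop
    exact this.continuousAt.eventually_mem (Iio_mem_nhds (by simp))
  filter_upwards [hev] with t ht
  have hu0 := posSemidef_one_sub_add_vecMulVec ht.le hC
  have hu := posSemidef_one_sub_bordered (a := 0) (by norm_num) hu0
  have hd := (one_sub_two_smul_posDef hu0).det_pos
  have h1 := h.integrable_exp hu
  have h2 := h _ hu
  rw [det_one_sub_bordered (one_sub_two_smul_posDef hu0)] at h2
  rw [← sub_sub, det_sub_smul_vecMulVec hC1.det_pos.ne'.isUnit] at h2 hd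
  simp only [zero_dotProduct, add_zero, sub_zero, mul_one] at h2
  rw [mul_rpow_of_mul_pos hC1.det_pos hd] at h2
  simp only [laplaceTransform, trace_bordered_mul_val, zero_mul, zero_dotProduct, mul_zero,
    zero_add, Matrix.add_mul, trace_add, smul_mul, trace_smul, smul_eq_mul,
    ← dotProduct_mulVec_eq_trace, add_comm (C * _).trace] at h1 h2 ⊢
  exact ⟨h1, h2⟩

end conditional

section conditional

open Filter Topology

variable {n : ℕ} {p : ℝ} {ν : Measure (PSDCone (n + 1))}

lemma integral_sub_sub {Ω : Type*} [MeasurableSpace Ω] {ρ : Measure Ω} {F G H : Ω → ℝ}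
    (hF : Integrable F ρ) (hG : Integrable G ρ) (hH : Integrable H ρ) :
    ∫ ω, F ω - G ω - H ω ∂ρ = ∫ ω, F ω ∂ρ - ∫ ω, G ω ∂ρ - ∫ ω, H ω ∂ρ := by
  rw [← integral_sub hF hG]
  exact integral_sub (hF.sub hG) hH

lemma continuous_corner : Continuous fun ξ : PSDCone (n + 1) => ξ.val 0 0 :=
  PSDCone.continuous_val.matrix_elem 0 0

lemma continuous_border (v : Fin n → ℝ) :
    Continuous fun ξ : PSDCone (n + 1) => v ⬝ᵥ fun i => ξ.val 0 i.succ :=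
  continuous_const.dotProduct (continuous_pi fun i => PSDCone.continuous_val.matrix_elem 0 i.succ)

lemma continuous_quadratic_lowerBlock (v : Fin n → ℝ) :
    Continuous fun ξ : PSDCone (n + 1) => v ⬝ᵥ ((lowerBlock ξ).val *ᵥ v) := by
  have : Continuous fun ξ : PSDCone (n + 1) => (lowerBlock ξ).val :=
    PSDCone.continuous_val.matrix_submatrix _ _
  fun_prop

lemma IsWishart.integrable_corner (h : IsWishart (n + 1) p ν) :
    Integrable (fun ξ => ξ.val 0 0) ν := by
  have hC : (-(0 : Matrix (Fin n) (Fin n) ℝ)).PosSemidef := by simpa using PosSemidef.zero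
  simpa using integrable_pow_mul_exp (measurable_trace_lowerBlock 0)
    ((h.exp_corner hC).mono fun t ht => ht.1) 1

lemma IsWishart.integrable_border_sq (h : IsWishart (n + 1) p ν) (v : Fin n → ℝ) :
    Integrable (fun ξ => 2 * (v ⬝ᵥ fun i => ξ.val 0 i.succ) ^ 2) ν := by
  have hC : (-(0 : Matrix (Fin n) (Fin n) ℝ)).PosSemidef := by simpa using PosSemidef.zero
  have := (integrable_pow_mul_exp (measurable_trace_lowerBlock 0)
    ((h.exp_border hC v).mono fun t ht => ht.1) 2).const_mul (1 / 2)
  refine this.congr (.of_forall fun ξ => ?_)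
  simp
  ring

lemma IsWishart.integrable_quadratic_lowerBlock (h : IsWishart (n + 1) p ν) (v : Fin n → ℝ) :
    Integrable (fun ξ => v ⬝ᵥ ((lowerBlock ξ).val *ᵥ v)) ν := by
  have hC : (-(0 : Matrix (Fin n) (Fin n) ℝ)).PosSemidef := by simpa using PosSemidef.zero
  simpa using integrable_pow_mul_exp (measurable_trace_lowerBlock 0)
    ((h.exp_lowerBlock hC v).mono fun t ht => ht.1) 1

/-- Given the lower block, the corner entry of a Wishart matrix has conditional mean `p`. -/
theorem IsWishart.integral_corner_mul (h : IsWishart (n + 1) p ν) (hp : 0 ≤ p)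
    {f : PSDCone n → ℝ} (hf : Measurable f) :
    ∫ ξ, ξ.val 0 0 * f (lowerBlock ξ) ∂ν = ∫ ξ, p * f (lowerBlock ξ) ∂ν := by
  have := h.isProbabilityMeasure
  refine integral_mul_comp_eq_of_laplace measurable_lowerBlock h.integrable_corner
    (integrable_const p) continuous_corner.measurable measurable_const
    (fun ξ => ξ.2.diag_nonneg) (fun _ => hp) (fun C hC => ?_) hf
  have hE := h.exp_corner hC
  have h1 := iteratedDeriv_eq_integral_pow_mul_exp (measurable_trace_lowerBlock C)
    (hE.mono fun t ht => ht.1) (hE.mono fun t ht => ht.2) 1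
  have h0 := hE.self_of_nhds.2
  simp only [zero_mul, zero_add, sub_zero, Real.one_rpow, mul_one] at h0
  rw [iteratedDeriv_one_mul_one_sub_rpow] at h1
  simp only [pow_one, mul_one] at h1
  rw [← h1, integral_const_mul, h0]

/-- Given the lower block `ξ'`, the border of a Wishart matrix has conditional second moments
`ξ' / 2`: the second derivative in the border of the Laplace transform is a first derivative in
the lower block. -/
theorem IsWishart.integral_border_sq_mul (h : IsWishart (n + 1) p ν) (v : Fin n → ℝ)
    {f : PSDCone n → ℝ} (hf : Measurable f) :
    ∫ ξ, 2 * (v ⬝ᵥ fun i => ξ.val 0 i.succ) ^ 2 * f (lowerBlock ξ) ∂ν =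
      ∫ ξ, (v ⬝ᵥ ((lowerBlock ξ).val *ᵥ v)) * f (lowerBlock ξ) ∂ν := by
  refine integral_mul_comp_eq_of_laplace measurable_lowerBlock (h.integrable_border_sq v)
    (h.integrable_quadratic_lowerBlock v)
    (((continuous_border v).pow 2).const_mul 2).measurable
    (continuous_quadratic_lowerBlock v).measurable (fun ξ => by positivity)
    (fun ξ => by simpa using (lowerBlock ξ).2.dotProduct_mulVec_nonneg v) (fun C hC => ?_) hf
  have hE := h.exp_border hC v
  have hF := h.exp_lowerBlock hC v
  have h1 := iteratedDeriv_eq_integral_pow_mul_exp (measurable_trace_lowerBlock C)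
    (hE.mono fun t ht => ht.1) (hE.mono fun t ht => ht.2) 2
  have h2 := iteratedDeriv_eq_integral_pow_mul_exp (measurable_trace_lowerBlock C)
    (hF.mono fun t ht => ht.1) (hF.mono fun t ht => ht.2) 1
  rw [iteratedDeriv_two_mul_one_sub_sq_rpow] at h1
  rw [iteratedDeriv_one_mul_one_sub_rpow] at h2
  simp only [pow_one] at h2
  rw [← h2, ← mul_right_inj' (two_ne_zero' ℝ), h1, ← integral_const_mul]
  exact integral_congr_ae (.of_forall fun ξ => by simp only; ring)

/-- The polarized form of the conditional second moments of the border. -/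
theorem IsWishart.integral_border_mul_border_mul (h : IsWishart (n + 1) p ν) (i j : Fin n)
    {f : PSDCone n → ℝ} (hf : Measurable f) (hb : ∀ η, |f η| ≤ 1) :
    Integrable (fun ξ => 2 * (ξ.val 0 i.succ * ξ.val 0 j.succ) * f (lowerBlock ξ)) ν ∧
    Integrable (fun ξ => (lowerBlock ξ).val i j * f (lowerBlock ξ)) ν ∧
    ∫ ξ, 2 * (ξ.val 0 i.succ * ξ.val 0 j.succ) * f (lowerBlock ξ) ∂ν =
      ∫ ξ, (lowerBlock ξ).val i j * f (lowerBlock ξ) ∂ν := by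
  have hfm := (hf.comp measurable_lowerBlock).aestronglyMeasurable (μ := ν)
  have hI : ∀ v : Fin n → ℝ, Integrable (fun ξ => 2 * (v ⬝ᵥ fun i => ξ.val 0 i.succ) ^ 2 *
      f (lowerBlock ξ)) ν := fun v =>
    (h.integrable_border_sq v).mul_bdd (c := 1) hfm (.of_forall fun ξ => hb _)
  have hJ : ∀ v, Integrable (fun ξ => (v ⬝ᵥ ((lowerBlock ξ).val *ᵥ v)) *
      f (lowerBlock ξ)) ν := fun v =>
    (h.integrable_quadratic_lowerBlock v).mul_bdd (c := 1) hfm (.of_forall fun ξ => hb _)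
  have hE := fun v => h.integral_border_sq_mul v hf
  set a : Fin n → ℝ := Pi.single i 1
  set b : Fin n → ℝ := Pi.single j 1
  have e1 : (fun ξ : PSDCone (n + 1) => 2 * (ξ.val 0 i.succ * ξ.val 0 j.succ) *
      f (lowerBlock ξ)) = fun ξ => 1 / 2 * ((2 * ((a + b) ⬝ᵥ fun i => ξ.val 0 i.succ) ^ 2 *
        f (lowerBlock ξ)) - (2 * (a ⬝ᵥ fun i => ξ.val 0 i.succ) ^ 2 * f (lowerBlock ξ)) -
        (2 * (b ⬝ᵥ fun i => ξ.val 0 i.succ) ^ 2 * f (lowerBlock ξ))) := by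
    funext ξ
    simp only [a, b, add_dotProduct, single_one_dotProduct]
    ring
  have e2 : (fun ξ : PSDCone (n + 1) => (lowerBlock ξ).val i j *
      f (lowerBlock ξ)) = fun ξ => 1 / 2 * (((a + b) ⬝ᵥ ((lowerBlock ξ).val *ᵥ (a + b))) *
        f (lowerBlock ξ) - (a ⬝ᵥ ((lowerBlock ξ).val *ᵥ a)) * f (lowerBlock ξ) -
        (b ⬝ᵥ ((lowerBlock ξ).val *ᵥ b)) * f (lowerBlock ξ)) := by
    funext ξ
    have hs : (lowerBlock ξ).val j i = (lowerBlock ξ).val i j := by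
      simpa using (lowerBlock ξ).2.1.apply i j
    simp only [a, b, add_dotProduct, mulVec_add, dotProduct_add, single_one_dotProduct,
      mulVec_single_one, col_apply, hs]
    ring
  have hI' := ((hI (a + b)).sub (hI a)).sub (hI b)
  have hJ' := ((hJ (a + b)).sub (hJ a)).sub (hJ b)
  refine ⟨by rw [e1]; exact hI'.const_mul _, by rw [e2]; exact hJ'.const_mul _, ?_⟩
  rw [e1, e2, integral_const_mul, integral_const_mul,
    integral_sub_sub (hI (a + b)) (hI a) (hI b), integral_sub_sub (hJ (a + b)) (hJ a) (hJ b),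
    hE, hE, hE]

end conditional

/-! ### Degeneracy of the lower block -/

section degenerate

variable {n : ℕ} {p : ℝ} {ν : Measure (PSDCone (n + 1))}

/-- A bounded weight on `S_n^+`, positive exactly on the invertible matrices `η`, and so small that
its products with the entries of `η⁻¹` are bounded too. -/
noncomputable def invWeight (η : PSDCone n) : ℝ :=
  if η.val.det = 0 then 0 else (1 + ∑ i, ∑ j, (η.val⁻¹ i j) ^ 2)⁻¹

lemma measurable_inv_apply (i j : Fin n) : Measurable fun η : PSDCone n => η.val⁻¹ i j := by
  have h : ∀ η : PSDCone n, η.val⁻¹ i j = η.val.det⁻¹ * η.val.adjugate i j := fun η => by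
    rw [Matrix.inv_def, Ring.inverse_eq_inv', Matrix.smul_apply, smul_eq_mul]
  simp_rw [h]
  have h1 : Continuous fun η : PSDCone n => η.val.det := by fun_prop
  have h2 : Continuous fun η : PSDCone n => η.val.adjugate i j :=
    PSDCone.continuous_val.matrix_adjugate.matrix_elem i j
  exact h1.measurable.inv.mul h2.measurable

lemma measurable_invWeight : Measurable (invWeight (n := n)) := by
  have h1 : Continuous fun η : PSDCone n => η.val.det := by fun_prop
  refine Measurable.ite (h1.measurable (measurableSet_singleton 0)) measurable_const ?_
  exact (measurable_const.add (Finset.measurable_sum _ fun i _ =>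
    Finset.measurable_sum _ fun j _ => (measurable_inv_apply i j).pow_const 2)).inv

lemma invWeight_nonneg (η : PSDCone n) : 0 ≤ invWeight η := by
  rw [invWeight]
  split_ifs <;> positivity

lemma det_eq_zero_of_invWeight {η : PSDCone n} (h : invWeight η = 0) : η.val.det = 0 := by
  by_contra h0
  rw [invWeight, if_neg h0] at h
  have : 0 < (1 + ∑ i, ∑ j, (η.val⁻¹ i j) ^ 2)⁻¹ := by positivity
  exact this.ne' h

lemma abs_invWeight_le (η : PSDCone n) : |invWeight η| ≤ 1 := by
  rw [abs_of_nonneg (invWeight_nonneg η), invWeight]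
  split_ifs
  · exact zero_le_one
  · exact inv_le_one_of_one_le₀ (le_add_of_nonneg_right (by positivity))

lemma abs_inv_apply_mul_invWeight_le (i j : Fin n) (η : PSDCone n) :
    |η.val⁻¹ i j * invWeight η| ≤ 1 := by
  rw [abs_mul, abs_of_nonneg (invWeight_nonneg η), invWeight]
  split_ifs
  · simp
  · set S := ∑ i, ∑ j, (η.val⁻¹ i j) ^ 2 with hS
    have h1 : (η.val⁻¹ i j) ^ 2 ≤ S :=
      (Finset.single_le_sum (f := fun j => (η.val⁻¹ i j) ^ 2) (fun _ _ => sq_nonneg _)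
        (Finset.mem_univ j)).trans
      (Finset.single_le_sum (f := fun i => ∑ j, (η.val⁻¹ i j) ^ 2)
        (fun _ _ => Finset.sum_nonneg fun _ _ => sq_nonneg _) (Finset.mem_univ i))
    have h2 : 0 < 1 + S := by positivity
    rw [← div_eq_mul_inv, div_le_one h2]
    nlinarith [sq_nonneg (|η.val⁻¹ i j| - 1), sq_abs (η.val⁻¹ i j)]

/-- The weighted Schur complement of the lower block is nonnegative, and it vanishes where
`det ξ = 0`: both follow from `det ξ = det ξ' * (ξ₁₁ - y ⬝ ξ'⁻¹ y)`. -/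
lemma invWeight_mul_schur (ξ : PSDCone (n + 1)) :
    0 ≤ invWeight (lowerBlock ξ) * (ξ.val 0 0 -
        (fun i : Fin n => ξ.val 0 i.succ) ⬝ᵥ
          ((lowerBlock ξ).val⁻¹ *ᵥ fun i => ξ.val 0 i.succ)) ∧
      (ξ.val.det = 0 → invWeight (lowerBlock ξ) * (ξ.val 0 0 -
        (fun i : Fin n => ξ.val 0 i.succ) ⬝ᵥ
          ((lowerBlock ξ).val⁻¹ *ᵥ fun i => ξ.val 0 i.succ)) = 0) := by
  by_cases h0 : (lowerBlock ξ).val.det = 0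
  · simp [invWeight, h0]
  have hdet := det_bordered (ξ.val 0 0) (fun i => ξ.val 0 i.succ) (lowerBlock ξ).val
    (Ne.isUnit h0)
  have heta : bordered (ξ.val 0 0) (fun i => ξ.val 0 i.succ) (lowerBlock ξ).val = ξ.val :=
    bordered_eta ξ.2.1
  rw [heta] at hdet
  have hpos : 0 < (lowerBlock ξ).val.det := lt_of_le_of_ne (lowerBlock ξ).2.det_nonneg (Ne.symm h0)
  constructor
  · refine mul_nonneg (invWeight_nonneg _) ?_
    have := ξ.2.det_nonneg
    rw [hdet] at this
    exact nonneg_of_mul_nonneg_right this hpos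
  · intro h
    rw [h] at hdet
    rw [(mul_eq_zero.1 hdet.symm).resolve_left h0, mul_zero]

lemma sum_mul_inv_mul_invWeight (η : PSDCone n) :
    ∑ i, ∑ j, η.val i j * (η.val⁻¹ i j * invWeight η) = n * invWeight η := by
  by_cases h0 : η.val.det = 0
  · simp [invWeight, h0]
  have hs : ∀ i j, η.val⁻¹ i j = η.val⁻¹ j i := fun i j => by
    simpa using (η.2.1.inv.apply i j).symm
  have : (η.val * η.val⁻¹).trace = n := by
    rw [mul_nonsing_inv _ (Ne.isUnit h0)]; simp
  simp_rw [← mul_assoc, ← Finset.sum_mul]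
  rw [← this]
  simp only [Matrix.trace, Matrix.diag, Matrix.mul_apply]
  congr 1
  exact Finset.sum_congr rfl fun i _ => Finset.sum_congr rfl fun j _ => by rw [hs i j]

/-- The conditional mean of the Schur complement of the lower block is `p - n / 2`. -/
theorem IsWishart.integral_schur (h : IsWishart (n + 1) p ν) (hp : 0 ≤ p) :
    ∫ ξ, invWeight (lowerBlock ξ) * (ξ.val 0 0 -
        (fun i : Fin n => ξ.val 0 i.succ) ⬝ᵥ
          ((lowerBlock ξ).val⁻¹ *ᵥ fun i => ξ.val 0 i.succ)) ∂ν =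
      (p - n / 2) * ∫ ξ, invWeight (lowerBlock ξ) ∂ν := by
  have hP := h.isProbabilityMeasure
  have hm := (measurable_invWeight.comp measurable_lowerBlock).aestronglyMeasurable (μ := ν)
  have hb := fun i j => h.integral_border_mul_border_mul i j
    (f := fun η => η.val⁻¹ i j * invWeight η)
    ((measurable_inv_apply i j).mul measurable_invWeight) (abs_inv_apply_mul_invWeight_le i j)
  have hc : Integrable (fun ξ => ξ.val 0 0 * invWeight (lowerBlock ξ)) ν :=
    h.integrable_corner.mul_bdd (c := 1) hm (.of_forall fun ξ => abs_invWeight_le _)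
  have hI : Integrable (fun ξ : PSDCone (n + 1) => ∑ i : Fin n, ∑ j : Fin n,
      2 * (ξ.val 0 i.succ * ξ.val 0 j.succ) *
        ((lowerBlock ξ).val⁻¹ i j * invWeight (lowerBlock ξ))) ν :=
    integrable_finsetSum _ fun i _ => integrable_finsetSum _ fun j _ => (hb i j).1
  -- Replacing `2 ξ₁ᵢ ξ₁ⱼ` by `ξ'ᵢⱼ` turns the quadratic form of `ξ'⁻¹` into `tr (ξ' ξ'⁻¹) = n`.
  have hs : ∫ ξ : PSDCone (n + 1), ∑ i : Fin n, ∑ j : Fin n,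
      2 * (ξ.val 0 i.succ * ξ.val 0 j.succ) *
        ((lowerBlock ξ).val⁻¹ i j * invWeight (lowerBlock ξ)) ∂ν =
      n * ∫ ξ, invWeight (lowerBlock ξ) ∂ν := by
    rw [← integral_const_mul]
    simp_rw [← sum_mul_inv_mul_invWeight]
    rw [integral_finsetSum _ fun i _ => integrable_finsetSum _ fun j _ => (hb i j).1,
      integral_finsetSum _ fun i _ => integrable_finsetSum _ fun j _ => (hb i j).2.1]
    refine Finset.sum_congr rfl fun i _ => ?_
    rw [integral_finsetSum _ fun j _ => (hb i j).1, integral_finsetSum _ fun j _ => (hb i j).2.1]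
    exact Finset.sum_congr rfl fun j _ => (hb i j).2.2
  have e : ∀ ξ : PSDCone (n + 1), invWeight (lowerBlock ξ) * (ξ.val 0 0 -
        (fun i : Fin n => ξ.val 0 i.succ) ⬝ᵥ
          ((lowerBlock ξ).val⁻¹ *ᵥ fun i => ξ.val 0 i.succ)) =
      ξ.val 0 0 * invWeight (lowerBlock ξ) - 1 / 2 * ∑ i : Fin n, ∑ j : Fin n,
      2 * (ξ.val 0 i.succ * ξ.val 0 j.succ) *
        ((lowerBlock ξ).val⁻¹ i j * invWeight (lowerBlock ξ)) := by
    intro ξ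
    rw [mul_sub, mul_comm]
    congr 1
    simp only [dotProduct, mulVec, Finset.mul_sum]
    exact Finset.sum_congr rfl fun i _ => Finset.sum_congr rfl fun j _ => by ring
  simp_rw [e]
  rw [integral_sub hc (hI.const_mul _), integral_const_mul (1 / 2 : ℝ), hs,
    h.integral_corner_mul hp measurable_invWeight, integral_const_mul]
  ring

/-- The lower block is almost surely singular if `p < n / 2`, and also if `p ≠ n / 2` and the whole
matrix is almost surely singular. -/
theorem IsWishart.ae_det_lowerBlock_eq_zero (h : IsWishart (n + 1) p ν) (hp : 0 ≤ p)
    (h' : p < n / 2 ∨ (p ≠ n / 2 ∧ ∀ᵐ ξ ∂ν, ξ.val.det = 0)) :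
    ∀ᵐ η ∂(ν.map lowerBlock), η.val.det = 0 := by
  have hP := h.isProbabilityMeasure
  have hm := (measurable_invWeight.comp measurable_lowerBlock).aestronglyMeasurable (μ := ν)
  have hint : Integrable (fun ξ : PSDCone (n + 1) => invWeight (lowerBlock ξ)) ν :=
    Integrable.of_bound hm 1 (.of_forall fun ξ => abs_invWeight_le _)
  have hnn : 0 ≤ ∫ ξ, invWeight (lowerBlock ξ) ∂ν := integral_nonneg fun ξ => invWeight_nonneg _
  have hzero : ∫ ξ, invWeight (lowerBlock ξ) ∂ν = 0 := by
    have key := h.integral_schur hp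
    rcases h' with hlt | ⟨hne, hsing⟩
    · have h1 : 0 ≤ (p - n / 2) * ∫ ξ, invWeight (lowerBlock ξ) ∂ν := by
        rw [← key]
        exact integral_nonneg fun ξ => (invWeight_mul_schur ξ).1
      nlinarith
    · rw [integral_eq_zero_of_ae (hsing.mono fun ξ hξ => (invWeight_mul_schur ξ).2 hξ)] at key
      exact (mul_eq_zero.1 key.symm).resolve_left (sub_ne_zero.2 hne)
  have hae := (integral_eq_zero_iff_of_nonneg (fun ξ => invWeight_nonneg _) hint).1 hzero
  have hdet : Continuous fun η : PSDCone n => η.val.det := by fun_prop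
  refine (ae_map_iff measurable_lowerBlock.aemeasurable
    (hdet.measurable (measurableSet_singleton 0))).2 ?_
  exact hae.mono fun ξ hξ => det_eq_zero_of_invWeight hξ

/-- Singularity would descend to the `0 × 0` block, whose determinant is `1`. -/
theorem IsWishart.not_ae_det_eq_zero {n : ℕ} {p : ℝ} {ν : Measure (PSDCone n)}
    (h : IsWishart n p ν) (hp : 0 ≤ p) (hp' : ∀ j : ℕ, j < n → p ≠ j / 2) :
    ¬ ∀ᵐ ξ ∂ν, ξ.val.det = 0 := by
  induction n with
  | zero =>
    intro H
    have := h.isProbabilityMeasure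
    obtain ⟨ξ, hξ⟩ := H.exists
    simp at hξ
  | succ n ih =>
    intro H
    exact ih h.map_lowerBlock (fun j hj => hp' j (by omega))
      (h.ae_det_lowerBlock_eq_zero hp (.inr ⟨hp' n (by omega), H⟩))

/-- The necessary condition on the shape parameter. For `p < (n - 1) / 2` the lower block of size
`n - 1` is singular, which is possible only if `p = j / 2` for some `j < n - 1`. -/
theorem IsWishart.le_or_eq {n : ℕ} {p : ℝ} {ν : Measure (PSDCone n)}
    (h : IsWishart n p ν) (hp : 0 ≤ p) :
    ((n : ℝ) - 1) / 2 ≤ p ∨ ∃ j : ℕ, j + 2 ≤ n ∧ p = j / 2 := by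
  rcases n with _ | n
  · left
    norm_num
    linarith
  by_contra! H
  obtain ⟨H1, H2⟩ := H
  push_cast at H1
  refine h.map_lowerBlock.not_ae_det_eq_zero hp (fun j hj => H2 j (by omega))
    (h.ae_det_lowerBlock_eq_zero hp (.inl (by linarith)))

end degenerate

/-! ### Reduction to the identity scale matrix -/

/-- A positive semidefinite matrix of rank `r` is `A Aᵀ` for a `d × r` matrix `A` with a left
inverse: the columns of `A` are the eigenvectors scaled by the roots of the nonzero eigenvalues. -/
theorem exists_rank_factorization {d : ℕ} {σ : Matrix (Fin d) (Fin d) ℝ} (hσ : σ.PosSemidef) :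
    ∃ (A : Matrix (Fin d) (Fin σ.rank) ℝ) (B : Matrix (Fin σ.rank) (Fin d) ℝ),
      σ = A * Aᵀ ∧ B * A = 1 := by
  set l := hσ.1.eigenvalues
  set U : Matrix (Fin d) (Fin d) ℝ := (hσ.1.eigenvectorUnitary : Matrix (Fin d) (Fin d) ℝ)
  have hcard : Fintype.card {i // l i ≠ 0} = σ.rank := hσ.1.rank_eq_card_non_zero_eigs.symm
  let e : Fin σ.rank ≃ {i // l i ≠ 0} := (Fintype.equivFinOfCardEq hcard).symm
  have hl0 : ∀ i, 0 ≤ l i := hσ.eigenvalues_nonneg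
  have hUU : Uᵀ * U = 1 := by
    have := Unitary.coe_star_mul_self hσ.1.eigenvectorUnitary
    simpa [star_eq_conjTranspose] using this
  have hspec : σ = U * diagonal l * Uᵀ := by
    have := hσ.1.spectral_theorem
    rw [Unitary.conjStarAlgAut_apply] at this
    simpa [star_eq_conjTranspose, Function.comp_def] using this
  have hsq : ∀ i : {i // l i ≠ 0}, √(l i) ≠ 0 := fun i =>
    (Real.sqrt_pos.2 (lt_of_le_of_ne (hl0 i) (Ne.symm i.2))).ne'
  refine ⟨of fun k i => U k (e i) * √(l (e i)), of fun i k => (√(l (e i)))⁻¹ * U k (e i), ?_, ?_⟩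
  · ext k m
    have h1 : ∀ i, U k i * l i * U m i = 0 ∨ l i ≠ 0 := fun i => by
      by_cases h : l i = 0
      · left; simp [h]
      · right; exact h
    have h2 : σ k m = ∑ i, U k i * l i * U m i := by
      conv_lhs => rw [hspec]
      simp [Matrix.mul_apply, diagonal_apply]
    have h3 : ∑ i : {i // l i ≠ 0}, U k i * l i * U m i = ∑ i, U k i * l i * U m i := by
      rw [← Finset.sum_subtype (Finset.univ.filter fun i => l i ≠ 0) (by simp)
        (fun i => U k i * l i * U m i)]
      exact Finset.sum_filter_of_ne fun i _ hi => (h1 i).resolve_left hi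
    rw [h2, ← h3, ← e.sum_comp]
    simp only [Matrix.mul_apply, of_apply, transpose_apply]
    refine Finset.sum_congr rfl fun i _ => ?_
    conv_lhs => rw [← Real.mul_self_sqrt (hl0 (e i))]
    ring
  · ext i j
    have h1 : ∑ k, U k (e i) * U k (e j) = (1 : Matrix (Fin d) (Fin d) ℝ) (e i) (e j) := by
      rw [← hUU]; rfl
    have h2 : (of (fun i k => (√(l (e i)))⁻¹ * U k (e i)) *
        of fun k i => U k (e i) * √(l (e i))) i j =
        (√(l (e i)))⁻¹ * √(l (e j)) * ∑ k, U k (e i) * U k (e j) := by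
      simp only [Matrix.mul_apply, of_apply, Finset.mul_sum]
      exact Finset.sum_congr rfl fun k _ => by ring
    rw [h2, h1]
    by_cases h : i = j
    · subst h
      simp [hsq]
    · have : (e i : Fin d) ≠ e j := fun H => h (e.injective (Subtype.ext H))
      rw [Matrix.one_apply_ne h, Matrix.one_apply_ne this, mul_zero]

/-- The map `ξ ↦ M ξ Mᵀ` between cones of positive semidefinite matrices. -/
def congruence {m n : ℕ} (M : Matrix (Fin m) (Fin n) ℝ) (ξ : PSDCone n) : PSDCone m :=
  ⟨M * ξ.val * Mᵀ, by simpa using ξ.2.mul_mul_conjTranspose_same M⟩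

lemma measurable_congruence {m n : ℕ} (M : Matrix (Fin m) (Fin n) ℝ) :
    Measurable (congruence M) :=
  Continuous.measurable (Continuous.subtype_mk (by fun_prop) _)

lemma laplaceTransform_map_congruence {m n : ℕ} (M : Matrix (Fin m) (Fin n) ℝ)
    (μ : Measure (PSDCone n)) (u : Matrix (Fin m) (Fin m) ℝ) :
    laplaceTransform (μ.map (congruence M)) u = laplaceTransform μ (Mᵀ * u * M) := by
  have hmeas : Measurable fun ξ : PSDCone m => Real.exp (u * ξ.val).trace :=
    (Real.continuous_exp.comp (PSDCone.continuous_trace_mul u)).measurable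
  rw [laplaceTransform, laplaceTransform,
    integral_map (measurable_congruence M).aemeasurable hmeas.aestronglyMeasurable]
  have : ∀ ξ : PSDCone n, (u * (congruence M ξ).val).trace = (Mᵀ * u * M * ξ.val).trace := by
    intro ξ
    rw [congruence, ← Matrix.mul_assoc, trace_mul_comm]
    simp only [Matrix.mul_assoc]
  simp_rw [this]

lemma posSemidef_neg_congruence {m n : ℕ} (M : Matrix (Fin m) (Fin n) ℝ)
    {u : Matrix (Fin m) (Fin m) ℝ} (hu : (-u).PosSemidef) : (-(Mᵀ * u * M)).PosSemidef := by
  simpa using hu.conjTranspose_mul_mul_same M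

lemma exists_dotProduct_mulVec_pos {d : ℕ} {σ : Matrix (Fin d) (Fin d) ℝ} (hσ : σ.PosSemidef)
    (hσ0 : σ ≠ 0) : ∃ v, 0 < v ⬝ᵥ (σ *ᵥ v) := by
  obtain ⟨v, hv⟩ := exists_dotProduct_mulVec_ne hσ.1 isHermitian_zero hσ0
  have := hσ.dotProduct_mulVec_nonneg v
  simp only [star_trivial, zero_mulVec, dotProduct_zero] at this hv
  exact ⟨v, lt_of_le_of_ne this (Ne.symm hv)⟩

theorem theorem1 (d : ℕ) (p : ℝ) (hp : 0 ≤ p) (σ : Matrix (Fin d) (Fin d) ℝ)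
    (hσ : σ.PosSemidef) (hσ0 : σ ≠ 0) :
    (∃ μ : Measure (PSDCone d), IsProbabilityMeasure μ ∧
        μ ≠ Measure.dirac (PSDCone.origin d) ∧
        ∀ u : Matrix (Fin d) (Fin d) ℝ, (-u).PosSemidef →
          laplaceTransform μ u = (1 - σ * u).det ^ (-p)) ↔
      p ∈ gindikinEnsemble σ.rank := by
  obtain ⟨A, B, hA, hB⟩ := exists_rank_factorization hσ
  have hmul : ∀ X : Matrix (Fin d) (Fin d) ℝ, σ * X = A * (Aᵀ * X) := fun X => by
    rw [← Matrix.mul_assoc, ← hA]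
  constructor
  · rintro ⟨μ, hμ, hne, hL⟩
    have hp0 : 0 < p := by
      refine lt_of_le_of_ne hp fun h0 => hne (ext_of_laplaceTransform fun u hu => ?_)
      rw [hL u hu, laplaceTransform_dirac_origin, ← h0, neg_zero, Real.rpow_zero]
    have hW := isWishart_of_laplaceTransform (μ := μ.map (congruence B)) (p := p) fun u hu => by
      rw [laplaceTransform_map_congruence, hL _ (posSemidef_neg_congruence B hu)]
      -- `σ Bᵀ u B = A (Aᵀ Bᵀ u B)`, and cycling `A` to the right leaves `u` since `B A = 1`.
      have h1 : σ * (Bᵀ * u * B) = A * ((B * A)ᵀ * u * B) := by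
        rw [hmul]
        simp only [transpose_mul, Matrix.mul_assoc]
      rw [h1, det_one_sub_mul_comm, Matrix.mul_assoc, hB]
      simp
    refine ⟨?_, hp0⟩
    rcases hW.le_or_eq hp with h | ⟨j, hj, rfl⟩
    · exact .inr h
    · refine .inl ⟨j, Nat.one_le_iff_ne_zero.2 ?_, hj, rfl⟩
      rintro rfl
      simp at hp0
  · rintro ⟨hmem, hp0⟩
    have hp0 : 0 < p := hp0
    obtain ⟨μ, hμ, hL⟩ : HasWishart σ.rank p := by
      refine hasWishart_of_mem ?_
      rcases hmem with ⟨j, -, -, hj⟩ | h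
      · exact .inl ⟨j, hj⟩
      · exact .inr h
    have hL' : ∀ u : Matrix (Fin d) (Fin d) ℝ, (-u).PosSemidef →
        laplaceTransform (μ.map (congruence A)) u = (1 - σ * u).det ^ (-p) := by
      intro u hu
      rw [laplaceTransform_map_congruence, hL _ (posSemidef_neg_congruence A hu)]
      rw [hmul, det_one_sub_mul_comm]
    refine ⟨μ.map (congruence A),
      Measure.isProbabilityMeasure_map (measurable_congruence A).aemeasurable,
      fun hdirac => ?_, hL'⟩
    obtain ⟨v, hv⟩ := exists_dotProduct_mulVec_pos hσ hσ0
    have h1 := hL' (-vecMulVec v v) (by simpa using posSemidef_vecMulVec_self v)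
    have h2 : (1 - σ * -vecMulVec v v).det = 1 + v ⬝ᵥ (σ *ᵥ v) := by
      rw [Matrix.mul_neg, sub_neg_eq_add, mul_vecMulVec, vecMulVec_eq Unit,
        det_one_add_replicateCol_mul_replicateRow]
    rw [hdirac, laplaceTransform_dirac_origin, h2] at h1
    exact (Real.rpow_lt_one_of_one_lt_of_neg (by linarith) (by linarith)).ne' h1
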